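/- Let $SG_2(n)$ be the two-dimensional Sierpinski gasket graph at stage $n$: $SG_2(0)$ is a triangle, and $SG_2(n+1)$ is obtained from three copies of $SG_2(n)$, placed as the three corner triangles of a triangle of twice the side length, by identifying the three pairs of outmost (corner) vertices at which two copies meet. For a finite graph $G$ let $v(G)$ be its number of vertices and $N_{SF}(G)$ its number of spanning forests, i.e. of acyclic subgraphs with the same vertex set as $G$ (isolated vertices count as trees). Let $f_2(n)=N_{SF}(SG_2(n))$, and let $t_2(n)$, $g_2(n)$ and $h_2(n)$ be the numbers of spanning forests of $SG_2(n)$ in which, respectively, the three outmost vertices belong to one tree; two fixed outmost vertices belong to one tree and the third to another tree; the three outmost vertices belong to three different trees. Then the limit $$z_{SG_2}=\lim_{n\to\infty}\frac{\ln N_{SF}(SG_2(n))}{v(SG_2(n))}$$ exists, and its decimal expansion begins $$z_{SG_2}=1.24733719931\ldots,\qquad\text{i.e. } 1.24733719931\le z_{SG_2}<1.24733719932 .$$ Moreover, for every integer $m\ge 1$, $$\frac{2}{3^{m+1}}\ln h_2(m)<z_{SG_2}<\frac{2}{3^{m+1}}\ln f_2(m),$$ $$\frac{2}{3^{m+1}}\ln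 f_2(m)-z_{SG_2}\le\frac{-1}{3^{m+1}}\ln\left(1-\left[\frac{t_2(m)}{f_2(m)}+\frac{g_2(m)}{f_2(m)}\right]^3\right),$$ and both $\frac{2}{3^{m+1}}\ln h_2(m)$ and $\frac{2}{3^{m+1}}\ln f_2(m)$ converge to $z_{SG_2}$ as $m\to\infty$. -/

import Mathlib

open Filter Topology

noncomputable section

/-- Number of spanning forests of a graph: the number of acyclic spanning subgraphs
(same vertex set, a subset of the edges). -/
def numSpanningForests {V : Type*} (G : SimpleGraph V) : ℕ :=
  Nat.card {H : SimpleGraph V // H ≤ G ∧ H.IsAcyclic}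

/-- Number of spanning forests of `G` in which the three given vertices lie in one tree. -/
def numForestsJoined {V : Type*} (G : SimpleGraph V) (a b c : V) : ℕ :=
  Nat.card {H : SimpleGraph V //
    H ≤ G ∧ H.IsAcyclic ∧ H.Reachable a b ∧ H.Reachable b c}

/-- Number of spanning forests of `G` in which `b` and `c` lie in one tree
and `a` lies in a different tree. -/
def numForestsOneApart {V : Type*} (G : SimpleGraph V) (a b c : V) : ℕ :=
  Nat.card {H : SimpleGraph V //
    H ≤ G ∧ H.IsAcyclic ∧ H.Reachable b c ∧ ¬ H.Reachable a b}

/-- Number of spanning forests of `G` in which the three given vertices lie in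
three different trees. -/
def numForestsApart {V : Type*} (G : SimpleGraph V) (a b c : V) : ℕ :=
  Nat.card {H : SimpleGraph V //
    H ≤ G ∧ H.IsAcyclic ∧ ¬ H.Reachable a b ∧ ¬ H.Reachable b c ∧ ¬ H.Reachable a c}

/-- Translation of the triangular lattice; the pair `(i, j)` stands for the lattice point
`i • e₁ + j • e₂`, where `e₁, e₂` are two unit vectors at an angle of 60 degrees. -/
def latticeShift (p : ℕ × ℕ) : (ℕ × ℕ) ↪ (ℕ × ℕ) := addRightEmbedding p

/-- Vertices of the two-dimensional Sierpinski gasket at stage `n`, in lattice coordinates: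
stage `0` is a unit triangle, and stage `n + 1` is the union of three copies of stage `n`,
placed so that any two of them share exactly one corner. -/
def gasketVertices : ℕ → Finset (ℕ × ℕ)
  | 0 => {(0, 0), (1, 0), (0, 1)}
  | n + 1 => gasketVertices n ∪ (gasketVertices n).map (latticeShift (2 ^ n, 0)) ∪
      (gasketVertices n).map (latticeShift (0, 2 ^ n))

/-- Adjacency of the Sierpinski gasket at stage `n`, as a graph on the whole lattice in which the
points outside `gasketVertices n` are isolated. -/
def gasketEdges : ℕ → SimpleGraph (ℕ × ℕ)
  | 0 => SimpleGraph.fromEdgeSet {s((0, 0), (1, 0)), s((0, 0), (0, 1)), s((1, 0), (0, 1))}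
  | n + 1 => gasketEdges n ⊔ (gasketEdges n).map (latticeShift (2 ^ n, 0)) ⊔
      (gasketEdges n).map (latticeShift (0, 2 ^ n))

/-- The two-dimensional Sierpinski gasket graph at stage `n`. -/
def gasket (n : ℕ) : SimpleGraph (gasketVertices n) :=
  (gasketEdges n).comap Subtype.val

theorem gasket_left_mem (n : ℕ) : (0, 0) ∈ gasketVertices n := by
  induction n with
  | zero => simp [gasketVertices]
  | succ n ih => simp [gasketVertices, ih]

theorem gasket_right_mem (n : ℕ) : (2 ^ n, 0) ∈ gasketVertices n := by
  induction n with
  | zero => simp [gasketVertices]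
  | succ n ih =>
    have : (2 ^ (n + 1), 0) ∈ (gasketVertices n).map (latticeShift (2 ^ n, 0)) :=
      Finset.mem_map.2 ⟨_, ih, by simp [latticeShift, pow_succ, mul_two]⟩
    simp [gasketVertices, this]

theorem gasket_top_mem (n : ℕ) : (0, 2 ^ n) ∈ gasketVertices n := by
  induction n with
  | zero => simp [gasketVertices]
  | succ n ih =>
    have : (0, 2 ^ (n + 1)) ∈ (gasketVertices n).map (latticeShift (0, 2 ^ n)) :=
      Finset.mem_map.2 ⟨_, ih, by simp [latticeShift, pow_succ, mul_two]⟩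
    simp [gasketVertices, this]

/-- The left outmost vertex. -/
def gasketLeft (n : ℕ) : gasketVertices n := ⟨(0, 0), gasket_left_mem n⟩

/-- The right outmost vertex. -/
def gasketRight (n : ℕ) : gasketVertices n := ⟨(2 ^ n, 0), gasket_right_mem n⟩

/-- The top outmost vertex. -/
def gasketTop (n : ℕ) : gasketVertices n := ⟨(0, 2 ^ n), gasket_top_mem n⟩

/-- Number of spanning forests of the stage `n` gasket. -/
def f₂ (n : ℕ) : ℕ := numSpanningForests (gasket n)

/-- Spanning forests of the stage `n` gasket with the three outmost vertices in one tree. -/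
def t₂ (n : ℕ) : ℕ :=
  numForestsJoined (gasket n) (gasketLeft n) (gasketRight n) (gasketTop n)

/-- Spanning forests of the stage `n` gasket with the left and the top outmost vertices in one tree
and the right one in another tree (by symmetry, the choice of the separated vertex does not
matter). -/
def g₂ (n : ℕ) : ℕ :=
  numForestsOneApart (gasket n) (gasketRight n) (gasketLeft n) (gasketTop n)

/-- Spanning forests of the stage `n` gasket with the three outmost vertices in three different
trees. -/
def h₂ (n : ℕ) : ℕ :=
  numForestsApart (gasket n) (gasketLeft n) (gasketRight n) (gasketTop n)

end

/-! A stage `n + 1` gasket is three stage `n` gaskets meeting pairwise in single corners, so every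
subgraph splits uniquely into three parts. Whether forests in the parts glue to a forest, and which
outer corners the result joins, depend only on which corners each part joins: a cycle appears
exactly when all three parts join their two shared corners. Summing over these corner states gives
the cubic recurrence `gasketTriple` for t, g, h.

With r = (t + g)/f, the proportion of forests joining two given corners, excluding the cyclic
triples gives f(n+1) = f(n)^3 (1 - r(n)^3) (`f₂_succ`), while h(n+1) > h(n)^3. Hence the rates
2/3^(m+1) ln f and 2/3^(m+1) ln h strictly decrease and strictly increase. Since t ≤ 3g and g ≤ h, f
≤ 7h, so they have a common limit; as v = (3^(n+1) + 3)/2, this is the growth constant.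

The error bound sums the corrections 2/3^(k+2) ln(1 - r(k)^3) for k ≥ m. Since r is nonincreasing,
they are dominated by a geometric series with sum 1/3^(m+1) times the logarithm at m
(`monotone_upperRate_add_log`). At m = 5, r is below 10^-6, so a rational enclosure of ln f(5)
yields the digits. -/

noncomputable section

/-! ### Unions of two graphs meeting in at most two vertices -/

namespace SimpleGraph

variable {V : Type*} {G₁ G₂ : SimpleGraph V} {S₁ S₂ : Set V} {y z : V}

/-- If the two parts of a union meet in at most two vertices `y`, `z`, a vertex reachable from the
first part is reached by a path of the first part that may be short-circuited once through the
second part, possibly followed by a path of the second part. -/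
theorem Reachable.exists_of_sup (h₁ : G₁.support ⊆ S₁) (h₂ : G₂.support ⊆ S₂)
    (hS : S₁ ∩ S₂ ⊆ {y, z}) {u w : V} (hu : u ∈ S₁) (h : (G₁ ⊔ G₂).Reachable u w) :
    ∃ a, a ∈ S₁ ∧ (G₁.Reachable u a ∨ G₂.Reachable y z ∧
        (G₁.Reachable u y ∧ G₁.Reachable z a ∨ G₁.Reachable u z ∧ G₁.Reachable y a)) ∧
      (a = w ∨ (a = y ∨ a = z) ∧ w ∈ S₂ ∧ G₂.Reachable a w) := by
  rw [reachable_iff_reflTransGen] at h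
  -- Here `a` is the end of the last step of the walk in `G₁`, or its start if there is none.
  -- Excursions into `G₂` between `y` and `z` need not accumulate: a second one cancels or repeats
  -- the first.
  induction h with
  | refl => exact ⟨u, hu, Or.inl .rfl, Or.inl rfl⟩
  | @tail b c _ hbc ih =>
    obtain ⟨a, ha, hua, hab⟩ := ih
    have key : ∀ v ∈ S₁, v ∈ S₂ → v = y ∨ v = z := fun v hv hv' => by simpa using hS ⟨hv, hv'⟩
    rcases hbc with hbc | hbc
    · have hb : b ∈ S₁ := h₁ ⟨c, hbc⟩
      have hc : c ∈ S₁ := h₁ ⟨b, hbc.symm⟩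
      have hR : G₁.Reachable b c := hbc.reachable
      refine ⟨c, hc, ?_, Or.inl rfl⟩
      rcases hab with rfl | ⟨hayz, hbS, hab⟩
      · rcases hua with h | ⟨h, h' | h'⟩
        · exact Or.inl (h.trans hR)
        · exact Or.inr ⟨h, Or.inl ⟨h'.1, h'.2.trans hR⟩⟩
        · exact Or.inr ⟨h, Or.inr ⟨h'.1, h'.2.trans hR⟩⟩
      · rcases hayz with rfl | rfl <;> rcases key b hb hbS with rfl | rfl
        · rcases hua with h | ⟨h, h' | h'⟩
          · exact Or.inl (h.trans hR)
          · exact Or.inl (h'.1.trans hR)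
          · exact Or.inr ⟨h, Or.inr ⟨h'.1, hR⟩⟩
        · rcases hua with h | ⟨h, h' | h'⟩
          · exact Or.inr ⟨hab, Or.inl ⟨h, hR⟩⟩
          · exact Or.inr ⟨hab, Or.inl ⟨h'.1, hR⟩⟩
          · exact Or.inl (h'.1.trans hR)
        · rcases hua with h | ⟨h, h' | h'⟩
          · exact Or.inr ⟨hab.symm, Or.inr ⟨h, hR⟩⟩
          · exact Or.inl (h'.1.trans hR)
          · exact Or.inr ⟨hab.symm, Or.inr ⟨h'.1, hR⟩⟩
        · rcases hua with h | ⟨h, h' | h'⟩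
          · exact Or.inl (h.trans hR)
          · exact Or.inr ⟨h, Or.inl ⟨h'.1, hR⟩⟩
          · exact Or.inl (h'.1.trans hR)
    · have hb : b ∈ S₂ := h₂ ⟨c, hbc⟩
      have hc : c ∈ S₂ := h₂ ⟨b, hbc.symm⟩
      have hR : G₂.Reachable b c := hbc.reachable
      rcases hab with rfl | ⟨hayz, hbS, hab⟩
      · exact ⟨a, ha, hua, Or.inr ⟨key a ha hb, hc, hR⟩⟩
      · exact ⟨a, ha, hua, Or.inr ⟨hayz, hc, hab.trans hR⟩⟩

/-- Reachability inside the first part of a union of two parts meeting in at most two vertices. -/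
theorem reachable_sup_iff (h₁ : G₁.support ⊆ S₁) (h₂ : G₂.support ⊆ S₂)
    (hS : S₁ ∩ S₂ ⊆ {y, z}) {u v : V} (hu : u ∈ S₁) (hv : v ∈ S₁) :
    (G₁ ⊔ G₂).Reachable u v ↔ G₁.Reachable u v ∨ G₂.Reachable y z ∧
      (G₁.Reachable u y ∧ G₁.Reachable z v ∨ G₁.Reachable u z ∧ G₁.Reachable y v) := by
  constructor
  · intro h
    obtain ⟨a, ha, hua, rfl | ⟨hayz, hvS, hav⟩⟩ := h.exists_of_sup h₁ h₂ hS hu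
    · exact hua
    · have hv' : v = y ∨ v = z := by simpa using hS ⟨hv, hvS⟩
      rcases hayz with rfl | rfl <;> rcases hv' with rfl | rfl
      · exact hua
      · rcases hua with h | ⟨h, h' | h'⟩
        · exact Or.inr ⟨hav, Or.inl ⟨h, .rfl⟩⟩
        · exact Or.inr ⟨hav, Or.inl ⟨h'.1, .rfl⟩⟩
        · exact Or.inl h'.1
      · rcases hua with h | ⟨h, h' | h'⟩
        · exact Or.inr ⟨hav.symm, Or.inr ⟨h, .rfl⟩⟩
        · exact Or.inl h'.1
        · exact Or.inr ⟨hav.symm, Or.inr ⟨h'.1, .rfl⟩⟩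
      · exact hua
  · have l : ∀ {a b}, G₁.Reachable a b → (G₁ ⊔ G₂).Reachable a b := fun h => h.mono le_sup_left
    have r : ∀ {a b}, G₂.Reachable a b → (G₁ ⊔ G₂).Reachable a b := fun h => h.mono le_sup_right
    rintro (h | ⟨h, h' | h'⟩)
    · exact l h
    · exact (l h'.1).trans ((r h).trans (l h'.2))
    · exact (l h'.1).trans ((r h.symm).trans (l h'.2))

/-- Reachability from the first to the second part of a union of two parts meeting in at most two
vertices. -/
theorem reachable_sup_iff_of_mem (h₁ : G₁.support ⊆ S₁) (h₂ : G₂.support ⊆ S₂)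
    (hS : S₁ ∩ S₂ = {y, z}) {u v : V} (hu : u ∈ S₁) (hv : v ∈ S₂) :
    (G₁ ⊔ G₂).Reachable u v ↔
      G₁.Reachable u y ∧ G₂.Reachable y v ∨ G₁.Reachable u z ∧ G₂.Reachable z v := by
  constructor
  · intro h
    obtain ⟨a, ha, hua, hav⟩ := h.exists_of_sup h₁ h₂ hS.subset hu
    have hav' : (a = y ∨ a = z) ∧ G₂.Reachable a v := by
      rcases hav with rfl | h
      · exact ⟨by simpa using hS.subset ⟨ha, hv⟩, .rfl⟩
      · exact ⟨h.1, h.2.2⟩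
    obtain ⟨rfl | rfl, hr⟩ := hav'
    · rcases hua with h | ⟨h, h' | h'⟩
      · exact Or.inl ⟨h, hr⟩
      · exact Or.inl ⟨h'.1, hr⟩
      · exact Or.inr ⟨h'.1, h.symm.trans hr⟩
    · rcases hua with h | ⟨h, h' | h'⟩
      · exact Or.inr ⟨h, hr⟩
      · exact Or.inl ⟨h'.1, h.trans hr⟩
      · exact Or.inr ⟨h'.1, hr⟩
  · rintro (h | h) <;> exact (h.1.mono le_sup_left).trans (h.2.mono le_sup_right)

/-- An edge of an acyclic first part stays a bridge in the union with a second part, if at most one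
of the parts joins the common vertices. -/
theorem IsAcyclic.not_reachable_deleteEdges_sup (h₁ : G₁.support ⊆ S₁) (h₂ : G₂.support ⊆ S₂)
    (hS : S₁ ∩ S₂ ⊆ {y, z}) (ha : G₁.IsAcyclic)
    (hyz : y = z ∨ ¬ (G₁.Reachable y z ∧ G₂.Reachable y z)) {u v : V} (huv : G₁.Adj u v) :
    ¬ (G₁.deleteEdges {s(u, v)} ⊔ G₂).Reachable u v := by
  have hb : ¬ (G₁.deleteEdges {s(u, v)}).Reachable u v :=
    isBridge_iff.1 (isAcyclic_iff_forall_adj_isBridge.1 ha huv)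
  have hle : G₁.deleteEdges {s(u, v)} ≤ G₁ := deleteEdges_le _
  have h₁' : (G₁.deleteEdges {s(u, v)}).support ⊆ S₁ := (support_mono hle).trans h₁
  rw [reachable_sup_iff h₁' h₂ hS (h₁ ⟨v, huv⟩) (h₁ ⟨u, huv.symm⟩)]
  rintro (h | ⟨h, h' | h'⟩)
  · exact hb h
  -- A detour from `u` to `v` through `G₂` uses `y` and `z`; closing it up with the edge `uv` joins
  -- `y` to `z` inside `G₁` as well, which `hyz` forbids.
  · rcases hyz with rfl | hyz
    · exact hb (h'.1.trans h'.2)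
    · exact hyz ⟨(h'.1.mono hle).symm.trans (huv.reachable.trans (h'.2.mono hle).symm), h⟩
  · rcases hyz with rfl | hyz
    · exact hb (h'.1.trans h'.2)
    · exact hyz ⟨(h'.2.mono hle).trans (huv.reachable.symm.trans (h'.1.mono hle)), h⟩

/-- A union of two edge-disjoint parts meeting in at most two vertices is acyclic if and only if
the parts are and at most one of them joins these two vertices. -/
theorem isAcyclic_sup_iff (h₁ : G₁.support ⊆ S₁) (h₂ : G₂.support ⊆ S₂)
    (hS : S₁ ∩ S₂ ⊆ {y, z}) (hd : Disjoint G₁ G₂) :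
    (G₁ ⊔ G₂).IsAcyclic ↔ G₁.IsAcyclic ∧ G₂.IsAcyclic ∧
      (y = z ∨ ¬ (G₁.Reachable y z ∧ G₂.Reachable y z)) := by
  constructor
  · intro h
    refine ⟨h.anti le_sup_left, h.anti le_sup_right, or_iff_not_imp_left.2 ?_⟩
    rintro hne ⟨⟨p⟩, ⟨q⟩⟩
    classical
    -- A path from `y` to `z` in either part is one in the acyclic union, so the two coincide; since
    -- `y ≠ z` they have an edge, which would lie in both parts.
    have hpq := (h.subsingleton_path y z).elim
      ⟨p.toPath.1.mapLe le_sup_left, p.toPath.2.mapLe le_sup_left⟩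
      ⟨q.toPath.1.mapLe le_sup_right, q.toPath.2.mapLe le_sup_right⟩
    have hed : p.toPath.1.edges = q.toPath.1.edges := by
      simpa only [Walk.edges_mapLe_eq_edges] using congrArg (fun r => r.1.edges) hpq
    rcases hp : p.toPath.1.edges with _ | ⟨e, l⟩
    · exact hne (Walk.eq_of_length_eq_zero (by rw [← Walk.length_edges, hp, List.length_nil]))
    · have he₁ : e ∈ G₁.edgeSet := p.toPath.1.edges_subset_edgeSet (by simp [hp])
      have he₂ : e ∈ G₂.edgeSet := q.toPath.1.edges_subset_edgeSet (by simp [← hed, hp])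
      exact Set.disjoint_left.1 (disjoint_edgeSet.2 hd) he₁ he₂
  · rintro ⟨ha₁, ha₂, hyz⟩
    rw [isAcyclic_iff_forall_adj_isBridge]
    intro u v huv
    rw [isBridge_iff, deleteEdges_sup]
    rcases huv with huv | huv
    · intro hr
      refine ha₁.not_reachable_deleteEdges_sup h₁ h₂ hS hyz huv (hr.mono ?_)
      exact sup_le_sup le_rfl (deleteEdges_le _)
    · intro hr
      refine ha₂.not_reachable_deleteEdges_sup h₂ h₁ (by rwa [Set.inter_comm])
        (hyz.imp id fun h h' => h h'.symm) huv
        (hr.mono ?_)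
      rw [sup_comm]
      exact sup_le_sup le_rfl (deleteEdges_le _)

end SimpleGraph

/-! ### Gluing three parts in a triangle -/

namespace SimpleGraph

variable {V : Type*}

open Classical in
/-- The connections among three given vertices: whether `a`, `b`, whether `b`, `c` and whether
`a`, `c` are joined. -/
def cornerState (H : SimpleGraph V) (a b c : V) : Bool × Bool × Bool :=
  (decide (H.Reachable a b), decide (H.Reachable b c), decide (H.Reachable a c))

/-- The number of spanning forests of `G` with prescribed connections among three vertices. -/
def forestCount (G : SimpleGraph V) (a b c : V) (s : Bool × Bool × Bool) : ℕ :=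
  Nat.card {H : SimpleGraph V // H ≤ G ∧ H.IsAcyclic ∧ H.cornerState a b c = s}

/-- The connections among the outer vertices `L`, `R`, `T` of three parts with corners `L, x, y`;
`x, R, z`; `y, z, T`, in terms of the connections inside the parts. -/
def glueState (a b c : Bool × Bool × Bool) : Bool × Bool × Bool :=
  ((a.1 && b.1) || (c.1 && (a.2.2 && b.2.1)),
    ((b.1 && a.2.1) && c.2.2) || (b.2.1 && c.2.1),
    (a.2.2 && c.2.2) || ((a.1 && b.2.2) && c.2.1))

/-- Three parts with corners `L, x, y`; `x, R, z`; `y, z, T` create no cycle through all of them. -/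
def glueAcyclic (a b c : Bool × Bool × Bool) : Bool :=
  !(a.2.1 && b.2.2 && c.1)

/-- Three vertex sets with corners `L, x, y`; `x, R, z`; `y, z, T`, pairwise meeting in a single
corner. -/
structure IsTriangleOf (S₁ S₂ S₃ : Set V) (L R T x y z : V) : Prop where
  inter₁₂ : S₁ ∩ S₂ = {x}
  inter₁₃ : S₁ ∩ S₃ = {y}
  inter₂₃ : S₂ ∩ S₃ = {z}
  left_mem : L ∈ S₁
  right_mem : R ∈ S₂
  top_mem : T ∈ S₃
  ne : y ≠ z

section

variable {S₁ S₂ S₃ : Set V} {L R T x y z : V} {G₁ G₂ G₃ : SimpleGraph V}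

theorem disjoint_of_support (h₁ : G₁.support ⊆ S₁) (h₂ : G₂.support ⊆ S₂)
    (hS : S₁ ∩ S₂ ⊆ {x}) : Disjoint G₁ G₂ := by
  rw [← disjoint_edgeSet, Set.disjoint_left]
  intro e
  induction e with
  | h u v =>
    intro h h'
    rw [mem_edgeSet] at h h'
    have hu : u = x := hS ⟨h₁ ⟨v, h⟩, h₂ ⟨v, h'⟩⟩
    have hv : v = x := hS ⟨h₁ ⟨u, h.symm⟩, h₂ ⟨u, h'.symm⟩⟩
    exact h.ne (hu.trans hv.symm)

theorem support_sup_subset (h₁ : G₁.support ⊆ S₁) (h₂ : G₂.support ⊆ S₂) :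
    (G₁ ⊔ G₂).support ⊆ S₁ ∪ S₂ := by
  rintro u ⟨v, h | h⟩
  · exact Or.inl (h₁ ⟨v, h⟩)
  · exact Or.inr (h₂ ⟨v, h⟩)

theorem reachable_sup_iff_of_inter_eq_singleton (h₁ : G₁.support ⊆ S₁) (h₂ : G₂.support ⊆ S₂)
    (hS : S₁ ∩ S₂ = {x}) {u v : V} (hu : u ∈ S₁) (hv : v ∈ S₁) :
    (G₁ ⊔ G₂).Reachable u v ↔ G₁.Reachable u v := by
  rw [reachable_sup_iff (y := x) (z := x) h₁ h₂ (by simp [hS]) hu hv]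
  exact ⟨fun h => h.elim id fun h => h.2.elim (fun h => h.1.trans h.2) fun h => h.1.trans h.2,
    Or.inl⟩

theorem reachable_sup_iff_of_inter_eq_singleton' (h₁ : G₁.support ⊆ S₁) (h₂ : G₂.support ⊆ S₂)
    (hS : S₁ ∩ S₂ = {x}) {u v : V} (hu : u ∈ S₁) (hv : v ∈ S₂) :
    (G₁ ⊔ G₂).Reachable u v ↔ G₁.Reachable u x ∧ G₂.Reachable x v := by
  rw [reachable_sup_iff_of_mem (y := x) (z := x) h₁ h₂ (by simp [hS]) hu hv, or_self]

theorem IsTriangleOf.inter_union (hT : IsTriangleOf S₁ S₂ S₃ L R T x y z) :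
    (S₁ ∪ S₂) ∩ S₃ = {y, z} := by
  rw [Set.union_inter_distrib_right, hT.inter₁₃, hT.inter₂₃]; rfl

/-- Gluing the first two parts at `x` alone never closes a cycle. Adding the third at `y` and `z`
closes one exactly when both sides join `y` to `z`, and in `G₁ ⊔ G₂` such a connection must pass
through `x`. -/
theorem IsTriangleOf.isAcyclic_iff (hT : IsTriangleOf S₁ S₂ S₃ L R T x y z)
    (h₁ : G₁.support ⊆ S₁) (h₂ : G₂.support ⊆ S₂) (h₃ : G₃.support ⊆ S₃) :
    (G₁ ⊔ G₂ ⊔ G₃).IsAcyclic ↔ (G₁.IsAcyclic ∧ G₂.IsAcyclic ∧ G₃.IsAcyclic) ∧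
      glueAcyclic (G₁.cornerState L x y) (G₂.cornerState x R z) (G₃.cornerState y z T) = true := by
  have d₁₂ := disjoint_of_support h₁ h₂ hT.inter₁₂.subset
  have d₁₃ := disjoint_of_support h₁ h₃ hT.inter₁₃.subset
  have d₂₃ := disjoint_of_support h₂ h₃ hT.inter₂₃.subset
  have hy : y ∈ S₁ := (hT.inter₁₃.symm.subset rfl).1
  have hz : z ∈ S₂ := (hT.inter₂₃.symm.subset rfl).1
  rw [isAcyclic_sup_iff (support_sup_subset h₁ h₂) h₃ hT.inter_union.subset
      (disjoint_sup_left.2 ⟨d₁₃, d₂₃⟩),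
    isAcyclic_sup_iff (y := x) (z := x) h₁ h₂ (by simp [hT.inter₁₂]) d₁₂,
    reachable_sup_iff_of_inter_eq_singleton' h₁ h₂ hT.inter₁₂ hy hz]
  simp [glueAcyclic, cornerState, hT.ne, reachable_comm (u := x) (v := y)]
  tauto

theorem IsTriangleOf.cornerState_sup (hT : IsTriangleOf S₁ S₂ S₃ L R T x y z)
    (h₁ : G₁.support ⊆ S₁) (h₂ : G₂.support ⊆ S₂) (h₃ : G₃.support ⊆ S₃) :
    (G₁ ⊔ G₂ ⊔ G₃).cornerState L R T =
      glueState (G₁.cornerState L x y) (G₂.cornerState x R z) (G₃.cornerState y z T) := by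
  have h₁₂ := support_sup_subset h₁ h₂
  have hy : y ∈ S₁ := (hT.inter₁₃.symm.subset rfl).1
  have hz : z ∈ S₂ := (hT.inter₂₃.symm.subset rfl).1
  have hL := hT.left_mem
  have hR := hT.right_mem
  have h₂₁ : S₂ ∩ S₁ = {x} := by rw [Set.inter_comm, hT.inter₁₂]
  have eLR := reachable_sup_iff_of_inter_eq_singleton' h₁ h₂ hT.inter₁₂ hL hR
  have eLz := reachable_sup_iff_of_inter_eq_singleton' h₁ h₂ hT.inter₁₂ hL hz
  have eyR := reachable_sup_iff_of_inter_eq_singleton' h₁ h₂ hT.inter₁₂ hy hR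
  have eLy := reachable_sup_iff_of_inter_eq_singleton h₁ h₂ hT.inter₁₂ hL hy
  have eRz := reachable_sup_iff_of_inter_eq_singleton h₂ h₁ h₂₁ hR hz
  rw [sup_comm] at eRz
  have kLR := reachable_sup_iff h₁₂ h₃ hT.inter_union.subset (Or.inl hL) (Or.inr hR)
  have kLT := reachable_sup_iff_of_mem h₁₂ h₃ hT.inter_union (Or.inl hL) hT.top_mem
  have kRT := reachable_sup_iff_of_mem h₁₂ h₃ hT.inter_union (Or.inr hR) hT.top_mem
  rw [reachable_comm (u := z) (v := R), eLR, eLy, eRz, eLz, eyR] at kLR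
  rw [eLy, eLz] at kLT
  rw [reachable_comm (u := R) (v := y), eyR, eRz] at kRT
  rw [reachable_comm (u := y) (v := x)] at kLR kRT
  refine Prod.ext (Bool.eq_iff_iff.2 ?_) (Prod.ext (Bool.eq_iff_iff.2 ?_) (Bool.eq_iff_iff.2 ?_))
  · simp only [glueState, cornerState, decide_eq_true_eq, Bool.or_eq_true, Bool.and_eq_true, kLR]
    constructor
    · rintro (h | ⟨h, h' | h'⟩)
      · exact Or.inl h
      · exact Or.inr ⟨h, h'⟩
      -- The route `L`, `z`, `y`, `R` visits `x` on both of its outer legs, so the third part is not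
      -- needed; this is why `glueState` has no such term.
      · exact Or.inl ⟨h'.1.1, h'.2.2⟩
    · rintro (h | h)
      · exact Or.inl h
      · exact Or.inr ⟨h.1, Or.inl h.2⟩
  · simp only [glueState, cornerState, decide_eq_true_eq, Bool.or_eq_true, Bool.and_eq_true, kRT]
    rw [and_comm (a := G₁.Reachable x y)]
  · simp only [glueState, cornerState, decide_eq_true_eq, Bool.or_eq_true, Bool.and_eq_true, kLT]

end

/-- The vertex type may be infinite, as it is for the whole lattice; finiteness comes from the
edges, since a subgraph is determined by its edge set. -/
theorem finite_forests {G : SimpleGraph V} (hG : G.edgeSet.Finite) (P : SimpleGraph V → Prop) :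
    Finite {H : SimpleGraph V // H ≤ G ∧ P H} := by
  have := hG.finite_subsets.to_subtype
  refine Finite.of_injective
    (fun H : {H : SimpleGraph V // H ≤ G ∧ P H} =>
      (⟨H.1.edgeSet, edgeSet_mono H.2.1⟩ : {s : Set (Sym2 V) | s ⊆ G.edgeSet})) ?_
  intro H H' h
  exact Subtype.ext (edgeSet_injective (congrArg Subtype.val h))

section

variable {S₁ S₂ S₃ : Set V} {L R T x y z : V} {G₁ G₂ G₃ : SimpleGraph V}

theorem sup_inf_eq_left_of_disjoint {H₁ H₂ H₃ : SimpleGraph V} (e₁ : H₁ ≤ G₁) (e₂ : H₂ ≤ G₂)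
    (e₃ : H₃ ≤ G₃) (d₂ : Disjoint G₁ G₂) (d₃ : Disjoint G₁ G₃) :
    (H₁ ⊔ H₂ ⊔ H₃) ⊓ G₁ = H₁ := by
  rw [inf_sup_right, inf_sup_right, inf_eq_left.2 e₁, (d₂.symm.mono_left e₂).eq_bot,
    (d₃.symm.mono_left e₃).eq_bot, sup_bot_eq, sup_bot_eq]

/-- A spanning forest of the union of three parts pairwise meeting in a single corner is a triple of
spanning forests of the parts which do not close a cycle. -/
def IsTriangleOf.forestEquiv (hT : IsTriangleOf S₁ S₂ S₃ L R T x y z)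
    (h₁ : G₁.support ⊆ S₁) (h₂ : G₂.support ⊆ S₂) (h₃ : G₃.support ⊆ S₃)
    (s : Bool × Bool × Bool) :
    {H : SimpleGraph V // H ≤ G₁ ⊔ G₂ ⊔ G₃ ∧ H.IsAcyclic ∧ H.cornerState L R T = s} ≃
      {p : {H : SimpleGraph V // H ≤ G₁ ∧ H.IsAcyclic} ×
          {H : SimpleGraph V // H ≤ G₂ ∧ H.IsAcyclic} ×
          {H : SimpleGraph V // H ≤ G₃ ∧ H.IsAcyclic} //
        glueAcyclic (p.1.1.cornerState L x y) (p.2.1.1.cornerState x R z)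
          (p.2.2.1.cornerState y z T) = true ∧
        glueState (p.1.1.cornerState L x y) (p.2.1.1.cornerState x R z)
          (p.2.2.1.cornerState y z T) = s} where
  toFun H :=
    have hs : H.1 ⊓ G₁ ⊔ H.1 ⊓ G₂ ⊔ H.1 ⊓ G₃ = H.1 := by
      rw [← inf_sup_left, ← inf_sup_left, inf_eq_left.2 H.2.1]
    have s₁ := (support_mono (inf_le_right : H.1 ⊓ G₁ ≤ G₁)).trans h₁
    have s₂ := (support_mono (inf_le_right : H.1 ⊓ G₂ ≤ G₂)).trans h₂
    have s₃ := (support_mono (inf_le_right : H.1 ⊓ G₃ ≤ G₃)).trans h₃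
    have ha := (hT.isAcyclic_iff s₁ s₂ s₃).1 (hs.symm ▸ H.2.2.1)
    ⟨⟨⟨H.1 ⊓ G₁, inf_le_right, ha.1.1⟩, ⟨H.1 ⊓ G₂, inf_le_right, ha.1.2.1⟩,
      ⟨H.1 ⊓ G₃, inf_le_right, ha.1.2.2⟩⟩, ha.2, by
        rw [← hT.cornerState_sup s₁ s₂ s₃, hs]; exact H.2.2.2⟩
  invFun p := ⟨p.1.1.1 ⊔ p.1.2.1.1 ⊔ p.1.2.2.1,
    sup_le_sup (sup_le_sup p.1.1.2.1 p.1.2.1.2.1) p.1.2.2.2.1, by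
      have s₁ := (support_mono p.1.1.2.1).trans h₁
      have s₂ := (support_mono p.1.2.1.2.1).trans h₂
      have s₃ := (support_mono p.1.2.2.2.1).trans h₃
      rw [hT.isAcyclic_iff s₁ s₂ s₃, hT.cornerState_sup s₁ s₂ s₃]
      exact ⟨⟨⟨p.1.1.2.2, p.1.2.1.2.2, p.1.2.2.2.2⟩, p.2.1⟩, p.2.2⟩⟩
  left_inv H := by
    apply Subtype.ext
    change H.1 ⊓ G₁ ⊔ H.1 ⊓ G₂ ⊔ H.1 ⊓ G₃ = H.1
    rw [← inf_sup_left, ← inf_sup_left, inf_eq_left.2 H.2.1]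
  right_inv := by
    rintro ⟨⟨⟨H₁, e₁, a₁⟩, ⟨H₂, e₂, a₂⟩, ⟨H₃, e₃, a₃⟩⟩, hp⟩
    have d₁₂ := disjoint_of_support h₁ h₂ hT.inter₁₂.subset
    have d₁₃ := disjoint_of_support h₁ h₃ hT.inter₁₃.subset
    have d₂₃ := disjoint_of_support h₂ h₃ hT.inter₂₃.subset
    refine Subtype.ext (Prod.ext (Subtype.ext ?_) (Prod.ext (Subtype.ext ?_) (Subtype.ext ?_)))
    · exact sup_inf_eq_left_of_disjoint e₁ e₂ e₃ d₁₂ d₁₃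
    · change (H₁ ⊔ H₂ ⊔ H₃) ⊓ G₂ = H₂
      rw [sup_comm H₁]
      exact sup_inf_eq_left_of_disjoint e₂ e₁ e₃ d₁₂.symm d₂₃
    · change (H₁ ⊔ H₂ ⊔ H₃) ⊓ G₃ = H₃
      rw [sup_comm, ← sup_assoc]
      exact sup_inf_eq_left_of_disjoint e₃ e₁ e₂ d₁₃.symm d₂₃.symm

theorem _root_.Fintype.sum_comp_eq_sum_card_mul {X K : Type*} [Fintype X] [Fintype K]
    [DecidableEq K] (σ : X → K) (F : K → ℕ) :
    ∑ p, F (σ p) = ∑ a, (∑ p, if σ p = a then 1 else 0) * F a := by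
  simp only [Finset.sum_mul, ite_mul, one_mul, zero_mul]
  rw [Finset.sum_comm]
  simp

/-- Counting triples by the values of three statistics. -/
theorem _root_.Nat.card_subtype_triple {X₁ X₂ X₃ K : Type*} [Finite X₁] [Finite X₂] [Finite X₃]
    [Fintype K] [DecidableEq K] (σ₁ : X₁ → K) (σ₂ : X₂ → K) (σ₃ : X₃ → K)
    (P : K → K → K → Prop) [∀ a b c, Decidable (P a b c)] :
    Nat.card {p : X₁ × X₂ × X₃ // P (σ₁ p.1) (σ₂ p.2.1) (σ₃ p.2.2)} =
      ∑ a, ∑ b, ∑ c, if P a b c then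
        Nat.card {p // σ₁ p = a} * (Nat.card {p // σ₂ p = b} * Nat.card {p // σ₃ p = c}) else 0 := by
  have := Fintype.ofFinite X₁
  have := Fintype.ofFinite X₂
  have := Fintype.ofFinite X₃
  simp only [Nat.card_eq_fintype_card, Fintype.card_subtype, Finset.card_filter,
    Fintype.sum_prod_type]
  rw [Fintype.sum_comp_eq_sum_card_mul σ₁ fun a => ∑ y, ∑ z, if P a (σ₂ y) (σ₃ z) then 1 else 0]
  refine Finset.sum_congr rfl fun a _ => ?_
  rw [Fintype.sum_comp_eq_sum_card_mul σ₂ fun b => ∑ z, if P a b (σ₃ z) then 1 else 0,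
    Finset.mul_sum]
  refine Finset.sum_congr rfl fun b _ => ?_
  rw [Fintype.sum_comp_eq_sum_card_mul σ₃ fun c => if P a b c then 1 else 0,
    Finset.mul_sum, Finset.mul_sum]
  refine Finset.sum_congr rfl fun c _ => ?_
  split_ifs
  · rw [mul_one]
  · simp

/-- Acyclicity and the state of a glued triple depend only on the states of its members, so the
triples are grouped by state and each group is a product. -/
theorem IsTriangleOf.forestCount_sup (hT : IsTriangleOf S₁ S₂ S₃ L R T x y z)
    (h₁ : G₁.support ⊆ S₁) (h₂ : G₂.support ⊆ S₂) (h₃ : G₃.support ⊆ S₃)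
    (f₁ : G₁.edgeSet.Finite) (f₂ : G₂.edgeSet.Finite) (f₃ : G₃.edgeSet.Finite)
    (s : Bool × Bool × Bool) :
    (G₁ ⊔ G₂ ⊔ G₃).forestCount L R T s =
      ∑ a, ∑ b, ∑ c, if glueAcyclic a b c = true ∧ glueState a b c = s then
          G₁.forestCount L x y a * (G₂.forestCount x R z b * G₃.forestCount y z T c)
        else 0 := by
  have i₁ := finite_forests f₁ fun H => H.IsAcyclic
  have i₂ := finite_forests f₂ fun H => H.IsAcyclic
  have i₃ := finite_forests f₃ fun H => H.IsAcyclic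
  have e : ∀ (G : SimpleGraph V) (a b c : V) (s : Bool × Bool × Bool),
      Nat.card {H : {H : SimpleGraph V // H ≤ G ∧ H.IsAcyclic} // H.1.cornerState a b c = s} =
        G.forestCount a b c s := fun G a b c s =>
    Nat.card_congr ((Equiv.subtypeSubtypeEquivSubtypeInter (fun H => H ≤ G ∧ H.IsAcyclic)
      fun H => H.cornerState a b c = s).trans
      (Equiv.subtypeEquivRight fun H => and_assoc))
  rw [forestCount, Nat.card_congr (hT.forestEquiv h₁ h₂ h₃ s)]
  refine (Nat.card_subtype_triple
    (fun H : {H : SimpleGraph V // H ≤ G₁ ∧ H.IsAcyclic} => H.1.cornerState L x y)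
    (fun H : {H : SimpleGraph V // H ≤ G₂ ∧ H.IsAcyclic} => H.1.cornerState x R z)
    (fun H : {H : SimpleGraph V // H ≤ G₃ ∧ H.IsAcyclic} => H.1.cornerState y z T)
    fun a b c => glueAcyclic a b c = true ∧ glueState a b c = s).trans ?_
  simp only [e]

end

end SimpleGraph

/-! ### Transport along embeddings, symmetric counts, and the single triangle -/

namespace SimpleGraph

variable {V W : Type*}

theorem reachable_map_iff (f : V ↪ W) {H : SimpleGraph V} {a b : V} :
    (H.map f).Reachable (f a) (f b) ↔ H.Reachable a b := by
  refine ⟨fun h => ?_, fun h => h.map (Embedding.map f H).toHom⟩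
  have key : ∀ w, (H.map f).Reachable (f a) w → ∃ b, f b = w ∧ H.Reachable a b := by
    intro w hw
    rw [reachable_iff_reflTransGen] at hw
    induction hw with
    -- Every edge of the image graph has both ends in the range of `f`, so a walk starting there
    -- lifts step by step.
    | refl => exact ⟨a, rfl, .rfl⟩
    | tail _ hbc ih =>
      obtain ⟨b, rfl, hb⟩ := ih
      obtain ⟨-, b', c, hadj, he, rfl⟩ := hbc
      obtain rfl := f.injective he
      exact ⟨c, rfl, hb.trans hadj.reachable⟩
  obtain ⟨b', hb', h'⟩ := key _ h
  exact f.injective hb' ▸ h'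

theorem isAcyclic_map_iff (f : V ↪ W) {H : SimpleGraph V} :
    (H.map f).IsAcyclic ↔ H.IsAcyclic := by
  constructor
  · intro h
    exact h.comap (Embedding.map f H).toHom f.injective
  · intro h
    rw [isAcyclic_iff_forall_adj_isBridge] at h ⊢
    rintro _ _ ⟨-, u, v, huv, rfl, rfl⟩
    have h' := h huv
    rw [isBridge_iff] at h' ⊢
    intro hr
    refine h' ((reachable_map_iff f).1 (hr.mono ?_))
    rintro p q hpq
    obtain ⟨⟨hne, a, b, hab, rfl, rfl⟩, hs⟩ := deleteEdges_adj.1 hpq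
    refine ⟨hne, a, b, deleteEdges_adj.2 ⟨hab, fun h => hs ?_⟩, rfl, rfl⟩
    simpa using h

theorem cornerState_map (f : V ↪ W) (H : SimpleGraph V) (a b c : V) :
    (H.map f).cornerState (f a) (f b) (f c) = H.cornerState a b c := by
  unfold cornerState
  congr 1
  · exact decide_eq_decide.2 (reachable_map_iff f)
  · congr 1 <;> exact decide_eq_decide.2 (reachable_map_iff f)

theorem map_comap_eq_of_le (f : V ↪ W) {G : SimpleGraph V} {H : SimpleGraph W}
    (h : H ≤ G.map f) : (H.comap f).map f = H := by
  refine le_antisymm (map_comap_le _ _) fun u v huv => ?_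
  obtain ⟨hne, a, b, -, rfl, rfl⟩ := h huv
  exact ⟨hne, a, b, huv, rfl, rfl⟩

/-- The forests of the image of a graph under an embedding are the images of its forests. -/
def forestMapEquiv (f : V ↪ W) (G : SimpleGraph V) (P : SimpleGraph V → Prop)
    (Q : SimpleGraph W → Prop) (h : ∀ H, Q (H.map f) ↔ P H) :
    {H : SimpleGraph V // H ≤ G ∧ P H} ≃ {H : SimpleGraph W // H ≤ G.map f ∧ Q H} where
  toFun H := ⟨H.1.map f, map_monotone f H.2.1, (h _).2 H.2.2⟩
  invFun H := ⟨H.1.comap f, (comap_monotone f H.2.1).trans (comap_map_eq f G).le,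
    (h _).1 ((map_comap_eq_of_le f H.2.1).symm ▸ H.2.2)⟩
  left_inv H := Subtype.ext (comap_map_eq f H.1)
  right_inv H := Subtype.ext (map_comap_eq_of_le f H.2.1)

theorem forestCount_map (f : V ↪ W) (G : SimpleGraph V) (a b c : V) (s : Bool × Bool × Bool) :
    (G.map f).forestCount (f a) (f b) (f c) s = G.forestCount a b c s :=
  (Nat.card_congr (forestMapEquiv f G _ _ fun H => by
    rw [isAcyclic_map_iff, cornerState_map])).symm

/-- The numbers of spanning forests of a graph by the connections among three symmetric corners. -/
def stateVector (t g h : ℕ) : Bool × Bool × Bool → ℕ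
  | (true, true, true) => t
  | (true, false, false) => g
  | (false, true, false) => g
  | (false, false, true) => g
  | (false, false, false) => h
  -- Exactly two connections among three vertices are impossible by transitivity.
  | _ => 0

theorem sum_glue_stateVector (t g h : ℕ) (s : Bool × Bool × Bool) :
    (∑ a, ∑ b, ∑ c, if glueAcyclic a b c = true ∧ glueState a b c = s then
      stateVector t g h a * (stateVector t g h b * stateVector t g h c) else 0) =
    stateVector (6 * g * t ^ 2 + 3 * g ^ 2 * t)
      (7 * g ^ 2 * t + 4 * g ^ 3 + h * t ^ 2 + 2 * g * h * t + g ^ 2 * h)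
      (12 * g * h * t + 3 * h ^ 2 * t + 14 * g ^ 3 + 24 * g ^ 2 * h + 9 * g * h ^ 2 + h ^ 3) s := by
  obtain ⟨s₁, s₂, s₃⟩ := s
  cases s₁ <;> cases s₂ <;> cases s₃ <;>
    simp [Fintype.sum_prod_type, stateVector, glueAcyclic, glueState] <;> ring

theorem edge_le_or_eq_bot {u v : V} {H : SimpleGraph V} (h : H ≤ edge u v) :
    H = ⊥ ∨ H = edge u v := by
  by_cases huv : H.Adj u v
  · exact Or.inr (le_antisymm h ((edge_le_iff _).2 (Or.inr huv)))
  · refine Or.inl (eq_bot_iff.2 fun a b hab => huv ?_)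
    rcases ((edge_adj _ _ _ _).1 (h hab)).1 with ⟨rfl, rfl⟩ | ⟨rfl, rfl⟩
    · exact hab
    · exact hab.symm

theorem isAcyclic_edge (u v : V) : (edge u v).IsAcyclic := by
  rw [isAcyclic_iff_forall_adj_isBridge]
  intro a b hab
  have hne : a ≠ b := hab.ne
  have hbot : (edge u v).deleteEdges {s(a, b)} = ⊥ := by
    refine eq_bot_iff.2 fun p q hpq => ?_
    obtain ⟨hpq, hs⟩ := deleteEdges_adj.1 hpq
    rcases ((edge_adj _ _ _ _).1 hab).1 with ⟨rfl, rfl⟩ | ⟨rfl, rfl⟩ <;>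
      rcases ((edge_adj _ _ _ _).1 hpq).1 with ⟨rfl, rfl⟩ | ⟨rfl, rfl⟩ <;>
      simp [Sym2.eq_swap] at hs
  rw [isBridge_iff, hbot, reachable_bot]
  exact hne

theorem forestCount_edge {u v : V} (huv : u ≠ v) (a b c : V) (s : Bool × Bool × Bool) :
    (edge u v).forestCount a b c s =
      (if (⊥ : SimpleGraph V).cornerState a b c = s then 1 else 0) +
        if (edge u v).cornerState a b c = s then 1 else 0 := by
  classical
  have hne : (⊥ : SimpleGraph V) ≠ edge u v := by
    intro h
    have : (edge u v).Adj u v := by simp [edge_adj, huv]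
    rw [← h] at this
    exact this
  have hset : {H : SimpleGraph V | H ≤ edge u v ∧ H.IsAcyclic ∧ H.cornerState a b c = s} =
      ↑(({⊥, edge u v} : Finset (SimpleGraph V)).filter fun H => H.cornerState a b c = s) := by
    ext H
    simp only [Set.mem_ofPred_eq, Finset.coe_filter, Finset.mem_insert, Finset.mem_singleton]
    constructor
    · exact fun h => ⟨edge_le_or_eq_bot h.1, h.2.2⟩
    · rintro ⟨rfl | rfl, h⟩
      · exact ⟨bot_le, isAcyclic_bot, h⟩
      · exact ⟨le_rfl, isAcyclic_edge u v, h⟩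
  change Nat.card ({H : SimpleGraph V | H ≤ edge u v ∧ H.IsAcyclic ∧ H.cornerState a b c = s}) = _
  rw [hset, Nat.card_coe_set_eq, Set.ncard_coe_finset, Finset.card_filter, Finset.sum_pair hne]

theorem support_edge_subset (u v : V) : (edge u v).support ⊆ {u, v} := by
  rintro a ⟨b, hab⟩
  rcases ((edge_adj _ _ _ _).1 hab).1 with ⟨rfl, rfl⟩ | ⟨rfl, rfl⟩ <;> simp

theorem finite_edgeSet_edge (u v : V) : (edge u v).edgeSet.Finite :=
  (Set.finite_singleton s(u, v)).subset edgeSet_edge_subset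

/-- The triangle is itself a gluing of three edges, with degenerate corner lists: `x = v`, `y = u`,
`z = w` coincide with outer corners. Each edge is either absent or present, which leaves eight
triples to inspect. -/
theorem forestCount_triangle {u v w : V} (huv : u ≠ v) (hvw : v ≠ w) (huw : u ≠ w) :
    (edge u v ⊔ edge v w ⊔ edge u w).forestCount u v w = stateVector 3 1 1 := by
  have hT : IsTriangleOf {u, v} {v, w} {u, w} u v w v u w := by
    refine ⟨?_, ?_, ?_, by simp, by simp, by simp, huw⟩ <;> ext t <;> simp <;> aesop
  have r₁ : (edge u v).Reachable u v := Adj.reachable (by simp [edge_adj, huv])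
  have r₂ : (edge v w).Reachable v w := Adj.reachable (by simp [edge_adj, hvw])
  have r₃ : (edge u w).Reachable u w := Adj.reachable (by simp [edge_adj, huw])
  funext s
  rw [hT.forestCount_sup (support_edge_subset _ _) (support_edge_subset _ _)
    (support_edge_subset _ _) (finite_edgeSet_edge _ _) (finite_edgeSet_edge _ _)
    (finite_edgeSet_edge _ _)]
  have c₁ : (edge u v).cornerState u v u = (true, true, true) := by
    simp [cornerState, r₁, r₁.symm]
  have c₂ : (edge v w).cornerState v v w = (true, true, true) := by
    simp [cornerState, r₂]
  have c₃ : (edge u w).cornerState u w w = (true, true, true) := by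
    simp [cornerState, r₃]
  have b₁ : (⊥ : SimpleGraph V).cornerState u v u = (false, false, true) := by
    simp [cornerState, reachable_bot, huv, huv.symm]
  have b₂ : (⊥ : SimpleGraph V).cornerState v v w = (true, false, false) := by
    simp [cornerState, reachable_bot, hvw]
  have b₃ : (⊥ : SimpleGraph V).cornerState u w w = (false, true, false) := by
    simp [cornerState, reachable_bot, huw]
  simp only [forestCount_edge huv, forestCount_edge hvw, forestCount_edge huw, c₁, c₂, c₃, b₁, b₂, b₃]
  obtain ⟨s₁, s₂, s₃⟩ := s
  cases s₁ <;> cases s₂ <;> cases s₃ <;>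
    simp [Fintype.sum_prod_type, stateVector, glueAcyclic, glueState]

end SimpleGraph

/-! ### The geometry of the gasket and its recurrence -/

open SimpleGraph

/-- This confinement to a triangle of side `2 ^ n` is what forces two translated copies to meet in a
single corner. -/
theorem gasketVertices_add_le {n : ℕ} {p : ℕ × ℕ} (hp : p ∈ gasketVertices n) :
    p.1 + p.2 ≤ 2 ^ n := by
  induction n generalizing p with
  | zero =>
    simp only [gasketVertices, Finset.mem_insert, Finset.mem_singleton] at hp
    rcases hp with rfl | rfl | rfl <;> simp
  | succ n ih =>
    simp only [gasketVertices, Finset.mem_union, Finset.mem_map] at hp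
    rcases hp with (hp | ⟨q, hq, rfl⟩) | ⟨q, hq, rfl⟩
    · have := ih hp
      rw [pow_succ]; omega
    all_goals
      have := ih hq
      simp only [latticeShift, addRightEmbedding_apply, Prod.fst_add, Prod.snd_add]
      rw [pow_succ]; omega

theorem latticeShift_apply (p q : ℕ × ℕ) : latticeShift p q = (q.1 + p.1, q.2 + p.2) := rfl

/-- The right copy of stage `n` inside stage `n + 1`. -/
def gasketRightCopy (n : ℕ) : Finset (ℕ × ℕ) := (gasketVertices n).map (latticeShift (2 ^ n, 0))

/-- The top copy of stage `n` inside stage `n + 1`. -/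
def gasketTopCopy (n : ℕ) : Finset (ℕ × ℕ) := (gasketVertices n).map (latticeShift (0, 2 ^ n))

theorem gasketVertices_inter_rightCopy (n : ℕ) :
    gasketVertices n ∩ gasketRightCopy n = {(2 ^ n, 0)} := by
  ext ⟨i, j⟩
  simp only [gasketRightCopy, Finset.mem_inter, Finset.mem_map, Finset.mem_singleton,
    latticeShift_apply, Prod.mk.injEq]
  constructor
  · rintro ⟨h, q, hq, h₁, h₂⟩
    have := gasketVertices_add_le h
    simp only at this
    omega
  · rintro ⟨rfl, rfl⟩
    exact ⟨gasket_right_mem n, (0, 0), gasket_left_mem n, by simp⟩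

theorem gasketVertices_inter_topCopy (n : ℕ) :
    gasketVertices n ∩ gasketTopCopy n = {(0, 2 ^ n)} := by
  ext ⟨i, j⟩
  simp only [gasketTopCopy, Finset.mem_inter, Finset.mem_map, Finset.mem_singleton,
    latticeShift_apply, Prod.mk.injEq]
  constructor
  · rintro ⟨h, q, hq, h₁, h₂⟩
    have := gasketVertices_add_le h
    simp only at this
    omega
  · rintro ⟨rfl, rfl⟩
    exact ⟨gasket_top_mem n, (0, 0), gasket_left_mem n, by simp⟩

theorem gasketRightCopy_inter_topCopy (n : ℕ) :
    gasketRightCopy n ∩ gasketTopCopy n = {(2 ^ n, 2 ^ n)} := by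
  ext ⟨i, j⟩
  simp only [gasketRightCopy, gasketTopCopy, Finset.mem_inter, Finset.mem_map,
    Finset.mem_singleton, latticeShift_apply, Prod.mk.injEq]
  constructor
  · rintro ⟨⟨p, hp, h₁, h₂⟩, q, hq, h₃, h₄⟩
    have := gasketVertices_add_le hp
    have := gasketVertices_add_le hq
    omega
  · rintro ⟨rfl, rfl⟩
    exact ⟨⟨(0, 2 ^ n), gasket_top_mem n, by simp⟩, (2 ^ n, 0), gasket_right_mem n, by simp⟩

theorem isTriangleOf_gasket (n : ℕ) :
    IsTriangleOf (gasketVertices n : Set (ℕ × ℕ)) (gasketRightCopy n) (gasketTopCopy n)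
      (0, 0) (2 ^ (n + 1), 0) (0, 2 ^ (n + 1)) (2 ^ n, 0) (0, 2 ^ n) (2 ^ n, 2 ^ n) where
  inter₁₂ := by rw [← Finset.coe_inter, gasketVertices_inter_rightCopy, Finset.coe_singleton]
  inter₁₃ := by rw [← Finset.coe_inter, gasketVertices_inter_topCopy, Finset.coe_singleton]
  inter₂₃ := by rw [← Finset.coe_inter, gasketRightCopy_inter_topCopy, Finset.coe_singleton]
  left_mem := gasket_left_mem n
  right_mem := Finset.mem_map.2 ⟨_, gasket_right_mem n, by simp [latticeShift_apply]; ring⟩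
  top_mem := Finset.mem_map.2 ⟨_, gasket_top_mem n, by simp [latticeShift_apply]; ring⟩
  ne := fun h => (Nat.two_pow_pos n).ne (Prod.ext_iff.1 h).1

/-- Inclusion–exclusion: three copies share three corners, so v(n+1) = 3 v(n) - 3. Doubling avoids
division in the naturals. -/
theorem two_mul_card_gasketVertices (n : ℕ) :
    2 * (gasketVertices n).card = 3 ^ (n + 1) + 3 := by
  induction n with
  | zero => rfl
  | succ n ih =>
    have hd : (gasketVertices n ∪ gasketRightCopy n) ∩ gasketTopCopy n =
        {(0, 2 ^ n), (2 ^ n, 2 ^ n)} := by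
      rw [Finset.union_inter_distrib_right, gasketVertices_inter_topCopy,
        gasketRightCopy_inter_topCopy]
      rfl
    have e₁ := Finset.card_union_add_card_inter (gasketVertices n) (gasketRightCopy n)
    have e₂ := Finset.card_union_add_card_inter (gasketVertices n ∪ gasketRightCopy n)
      (gasketTopCopy n)
    rw [gasketVertices_inter_rightCopy, Finset.card_singleton] at e₁
    rw [hd, Finset.card_pair (by simp [(Nat.two_pow_pos n).ne])] at e₂
    have c₁ : (gasketRightCopy n).card = (gasketVertices n).card := Finset.card_map _
    have c₂ : (gasketTopCopy n).card = (gasketVertices n).card := Finset.card_map _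
    change 2 * (gasketVertices n ∪ gasketRightCopy n ∪ gasketTopCopy n).card = _
    rw [pow_succ 3 (n + 1)]
    omega

theorem gasketEdges_zero :
    gasketEdges 0 = edge (0, 0) (1, 0) ⊔ edge (1, 0) (0, 1) ⊔ edge (0, 0) (0, 1) := by
  ext u v
  simp only [gasketEdges, fromEdgeSet_adj, Set.mem_insert_iff, Set.mem_singleton_iff, sup_adj,
    edge_adj, Sym2.eq_iff]
  tauto

theorem support_gasketEdges (n : ℕ) : (gasketEdges n).support ⊆ gasketVertices n := by
  induction n with
  | zero =>
    rw [gasketEdges_zero]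
    refine (support_sup_subset (support_sup_subset (support_edge_subset _ _)
      (support_edge_subset _ _)) (support_edge_subset _ _)).trans ?_
    intro p hp
    simp [gasketVertices] at hp ⊢
    tauto
  | succ n ih =>
    have h : ∀ p, ((gasketEdges n).map (latticeShift p)).support ⊆
        ((gasketVertices n).map (latticeShift p) : Finset (ℕ × ℕ)) := fun p => by
      rw [support_map, Finset.coe_map]
      exact Set.image_mono ih
    refine (support_sup_subset (support_sup_subset ih (h _)) (h _)).trans ?_
    rw [← Finset.coe_union, ← Finset.coe_union]
    rfl

theorem finite_edgeSet_gasketEdges (n : ℕ) : (gasketEdges n).edgeSet.Finite := by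
  induction n with
  | zero =>
    rw [gasketEdges_zero, edgeSet_sup, edgeSet_sup]
    exact ((finite_edgeSet_edge _ _).union (finite_edgeSet_edge _ _)).union (finite_edgeSet_edge _ _)
  | succ n ih =>
    rw [gasketEdges, edgeSet_sup, edgeSet_sup, edgeSet_map, edgeSet_map]
    exact (ih.union (ih.image _)).union (ih.image _)

/-- The recurrence for the numbers of spanning forests with the three corners in one tree, with one
given corner separated, and with all corners separated. -/
def gasketTriple : ℕ → ℕ × ℕ × ℕ
  | 0 => (3, 1, 1)
  | n + 1 =>
    let t := (gasketTriple n).1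
    let g := (gasketTriple n).2.1
    let h := (gasketTriple n).2.2
    (6 * g * t ^ 2 + 3 * g ^ 2 * t,
      7 * g ^ 2 * t + 4 * g ^ 3 + h * t ^ 2 + 2 * g * h * t + g ^ 2 * h,
      12 * g * h * t + 3 * h ^ 2 * t + 14 * g ^ 3 + 24 * g ^ 2 * h + 9 * g * h ^ 2 + h ^ 3)

theorem forestCount_gasketEdges (n : ℕ) :
    (gasketEdges n).forestCount (0, 0) (2 ^ n, 0) (0, 2 ^ n) =
      stateVector (gasketTriple n).1 (gasketTriple n).2.1 (gasketTriple n).2.2 := by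
  induction n with
  | zero =>
    rw [gasketEdges_zero]
    exact forestCount_triangle (by simp) (by simp) (by simp)
  | succ n ih =>
    funext s
    have hm : ∀ p a b c, ((gasketEdges n).map (latticeShift p)).forestCount (latticeShift p a)
        (latticeShift p b) (latticeShift p c) = (gasketEdges n).forestCount a b c := fun p a b c =>
      funext fun s => forestCount_map _ _ _ _ _ _
    have h₂ := hm (2 ^ n, 0) (0, 0) (2 ^ n, 0) (0, 2 ^ n)
    have h₃ := hm (0, 2 ^ n) (0, 0) (2 ^ n, 0) (0, 2 ^ n)
    simp only [latticeShift_apply, zero_add, ← Nat.two_pow_succ] at h₂ h₃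
    simp only [add_zero] at h₂ h₃
    have hs : ∀ p, ((gasketEdges n).map (latticeShift p)).support ⊆
        ((gasketVertices n).map (latticeShift p) : Finset (ℕ × ℕ)) := fun p => by
      rw [support_map, Finset.coe_map]
      exact Set.image_mono (support_gasketEdges n)
    have hf : ∀ p, ((gasketEdges n).map (latticeShift p)).edgeSet.Finite := fun p => by
      rw [edgeSet_map]
      exact (finite_edgeSet_gasketEdges n).image _
    rw [gasketEdges, (isTriangleOf_gasket n).forestCount_sup (support_gasketEdges n) (hs _) (hs _)
      (finite_edgeSet_gasketEdges n) (hf _) (hf _), h₂, h₃, ih, sum_glue_stateVector]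
    rfl

/-- The lattice points outside the gasket are isolated, so forest counts may be made on the whole
lattice, where the three copies live on one vertex type. -/
theorem map_gasket (n : ℕ) :
    (gasket n).map (Function.Embedding.subtype (· ∈ gasketVertices n)) = gasketEdges n := by
  refine le_antisymm (map_comap_le _ _) fun u v huv => ⟨huv.ne, ⟨u, ?_⟩, ⟨v, ?_⟩, huv, rfl, rfl⟩
  · exact support_gasketEdges n ⟨v, huv⟩
  · exact support_gasketEdges n ⟨u, huv.symm⟩

theorem forestCount_gasket (n : ℕ) :
    (gasket n).forestCount (gasketLeft n) (gasketRight n) (gasketTop n) =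
      stateVector (gasketTriple n).1 (gasketTriple n).2.1 (gasketTriple n).2.2 := by
  rw [← forestCount_gasketEdges, ← map_gasket]
  exact funext fun s => (forestCount_map (Function.Embedding.subtype (· ∈ gasketVertices n))
    (gasket n) (gasketLeft n) (gasketRight n) (gasketTop n) s).symm

theorem t₂_eq (n : ℕ) : t₂ n = (gasketTriple n).1 := by
  have := congrFun (forestCount_gasket n) (true, true, true)
  rw [stateVector] at this
  rw [← this]
  refine Nat.card_congr (Equiv.subtypeEquivRight fun H => ?_)
  simp only [cornerState, Prod.mk.injEq, decide_eq_true_eq]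
  exact and_congr_right fun _ => and_congr_right fun _ =>
    ⟨fun h => ⟨h.1, h.2, h.1.trans h.2⟩, fun h => ⟨h.1, h.2.1⟩⟩

theorem g₂_eq (n : ℕ) : g₂ n = (gasketTriple n).2.1 := by
  have := congrFun (forestCount_gasket n) (false, false, true)
  rw [stateVector] at this
  rw [← this]
  refine Nat.card_congr (Equiv.subtypeEquivRight fun H => ?_)
  simp only [cornerState, Prod.mk.injEq, decide_eq_true_eq, decide_eq_false_iff_not]
  exact and_congr_right fun _ => and_congr_right fun _ =>
    ⟨fun h => ⟨fun h' => h.2 h'.symm, fun h' => h.2 (h'.trans h.1.symm), h.1⟩,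
      fun h => ⟨h.2.2, fun h' => h.1 h'.symm⟩⟩

theorem h₂_eq (n : ℕ) : h₂ n = (gasketTriple n).2.2 := by
  have := congrFun (forestCount_gasket n) (false, false, false)
  rw [stateVector] at this
  rw [← this]
  refine Nat.card_congr (Equiv.subtypeEquivRight fun H => ?_)
  simp only [cornerState, Prod.mk.injEq, decide_eq_false_iff_not]

theorem SimpleGraph.numSpanningForests_eq_sum {V : Type*} [Finite V] (G : SimpleGraph V)
    (a b c : V) : numSpanningForests G = ∑ s, G.forestCount a b c s := by
  have e : ∀ s, G.forestCount a b c s =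
      Nat.card {H : {H : SimpleGraph V // H ≤ G ∧ H.IsAcyclic} // H.1.cornerState a b c = s} :=
    fun s => (Nat.card_congr ((Equiv.subtypeSubtypeEquivSubtypeInter
      (fun H => H ≤ G ∧ H.IsAcyclic) fun H => H.cornerState a b c = s).trans
      (Equiv.subtypeEquivRight fun H => and_assoc))).symm
  have := finite_forests G.edgeSet.toFinite fun H => H.IsAcyclic
  simp only [e]
  rw [← Nat.card_sigma]
  exact Nat.card_congr (Equiv.sigmaFiberEquiv _).symm

theorem f₂_eq (n : ℕ) :
    f₂ n = (gasketTriple n).1 + 3 * (gasketTriple n).2.1 + (gasketTriple n).2.2 := by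
  rw [f₂, numSpanningForests_eq_sum _ (gasketLeft n) (gasketRight n) (gasketTop n),
    forestCount_gasket]
  simp [Fintype.sum_prod_type, stateVector]
  ring

/-! ### Inequalities between t, g, h and the joined ratio -/

theorem gasketTriple_succ {n t g h : ℕ} (hn : gasketTriple n = (t, g, h)) :
    gasketTriple (n + 1) = (6 * g * t ^ 2 + 3 * g ^ 2 * t,
      7 * g ^ 2 * t + 4 * g ^ 3 + h * t ^ 2 + 2 * g * h * t + g ^ 2 * h,
      12 * g * h * t + 3 * h ^ 2 * t + 14 * g ^ 3 + 24 * g ^ 2 * h + 9 * g * h ^ 2 + h ^ 3) := by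
  simp only [gasketTriple, hn]

/-- The two inequalities are propagated together; they give f ≤ 7h, the bounded ratio behind the
common limit of the two rates. -/
theorem gasketTriple_bounds (n : ℕ) :
    0 < (gasketTriple n).1 ∧ 0 < (gasketTriple n).2.1 ∧
      (gasketTriple n).1 ≤ 3 * (gasketTriple n).2.1 ∧
      (gasketTriple n).2.1 ≤ (gasketTriple n).2.2 := by
  induction n with
  | zero => simp [gasketTriple]
  | succ n ih =>
    rcases hn : gasketTriple n with ⟨t, g, h⟩
    rw [hn] at ih
    rw [gasketTriple_succ hn]
    obtain ⟨ht, hg, htg, hgh⟩ := ih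
    simp only at ht hg htg hgh ⊢
    refine ⟨by positivity, by positivity, ?_, ?_⟩
    -- 6gt² ≤ 18g²t brings the new t to at most 21g²t, exactly three times the first term of the new
    -- g.
    · have := Nat.mul_le_mul_left (6 * g * t) htg
      nlinarith [Nat.zero_le (g ^ 2 * t), Nat.zero_le (g ^ 3), Nat.zero_le (h * t ^ 2),
        Nat.zero_le (g * h * t), Nat.zero_le (g ^ 2 * h)]
    -- 7g²t ≤ 7ght and ht² ≤ 3ght, which with 2ght use up exactly the 12ght of the new h.
    · have h₁ := Nat.mul_le_mul_left (7 * g * t) hgh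
      have h₂ := Nat.mul_le_mul_left (h * t) htg
      nlinarith [Nat.zero_le (g ^ 2 * h), Nat.zero_le (g ^ 3), Nat.zero_le (h ^ 2 * t),
        Nat.zero_le (g * h * t), Nat.zero_le (g * h ^ 2), Nat.zero_le (h ^ 3)]

theorem h₂_pos (n : ℕ) : 0 < h₂ n := by
  obtain ⟨-, h, -, h'⟩ := gasketTriple_bounds n
  rw [h₂_eq]
  exact h.trans_le h'

theorem f₂_eq_add (n : ℕ) : f₂ n = t₂ n + 3 * g₂ n + h₂ n := by
  rw [f₂_eq, t₂_eq, g₂_eq, h₂_eq]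

theorem t₂_pos (n : ℕ) : 0 < t₂ n := t₂_eq n ▸ (gasketTriple_bounds n).1

theorem g₂_pos (n : ℕ) : 0 < g₂ n := g₂_eq n ▸ (gasketTriple_bounds n).2.1

theorem h₂_le_f₂ (n : ℕ) : h₂ n ≤ f₂ n := by
  have := f₂_eq_add n
  omega

theorem f₂_le_h₂ (n : ℕ) : f₂ n ≤ 7 * h₂ n := by
  obtain ⟨-, -, h, h'⟩ := gasketTriple_bounds n
  rw [f₂_eq, h₂_eq]
  omega

theorem f₂_pos (n : ℕ) : 0 < f₂ n := (h₂_pos n).trans_le (h₂_le_f₂ n)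

theorem t₂_succ (n : ℕ) : t₂ (n + 1) = 6 * g₂ n * t₂ n ^ 2 + 3 * g₂ n ^ 2 * t₂ n := by
  simp only [t₂_eq, g₂_eq, gasketTriple]

theorem g₂_succ (n : ℕ) : g₂ (n + 1) = 7 * g₂ n ^ 2 * t₂ n + 4 * g₂ n ^ 3 + h₂ n * t₂ n ^ 2 +
    2 * g₂ n * h₂ n * t₂ n + g₂ n ^ 2 * h₂ n := by
  simp only [t₂_eq, g₂_eq, h₂_eq, gasketTriple]

theorem h₂_succ (n : ℕ) : h₂ (n + 1) = 12 * g₂ n * h₂ n * t₂ n + 3 * h₂ n ^ 2 * t₂ n +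
    14 * g₂ n ^ 3 + 24 * g₂ n ^ 2 * h₂ n + 9 * g₂ n * h₂ n ^ 2 + h₂ n ^ 3 := by
  simp only [t₂_eq, g₂_eq, h₂_eq, gasketTriple]

/-- The proportion of spanning forests joining two given corners. -/
def joinedRatio (n : ℕ) : ℝ := (t₂ n : ℝ) / f₂ n + (g₂ n : ℝ) / f₂ n

theorem joinedRatio_eq (n : ℕ) : joinedRatio n = ((t₂ n : ℝ) + g₂ n) / f₂ n := by
  rw [joinedRatio, add_div]

theorem joinedRatio_pos (n : ℕ) : 0 < joinedRatio n := by
  have h₁ : (0 : ℝ) < t₂ n := by exact_mod_cast t₂_pos n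
  have h₂ : (0 : ℝ) < g₂ n := by exact_mod_cast g₂_pos n
  have h₃ : (0 : ℝ) < f₂ n := by exact_mod_cast f₂_pos n
  rw [joinedRatio]
  positivity

theorem joinedRatio_lt_one (n : ℕ) : joinedRatio n < 1 := by
  have h₃ : (0 : ℝ) < f₂ n := by exact_mod_cast f₂_pos n
  rw [joinedRatio_eq, div_lt_one h₃]
  have := f₂_eq_add n
  have := g₂_pos n
  exact_mod_cast (by omega : t₂ n + g₂ n < f₂ n)

theorem one_sub_joinedRatio_pow_pos (n : ℕ) : 0 < 1 - joinedRatio n ^ 3 :=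
  sub_pos.2 (pow_lt_one₀ (joinedRatio_pos n).le (joinedRatio_lt_one n) three_ne_zero)

/-- Of the f³ triples of forests, the ones that close a cycle are those in which each part joins its
two shared corners, and each part does so in t + g ways. -/
theorem f₂_succ (n : ℕ) : (f₂ (n + 1) : ℝ) = (f₂ n : ℝ) ^ 3 * (1 - joinedRatio n ^ 3) := by
  have h₃ : (f₂ n : ℝ) ≠ 0 := by exact_mod_cast (f₂_pos n).ne'
  rw [joinedRatio_eq, mul_sub, mul_one, ← mul_pow, mul_div_cancel₀ _ h₃, f₂_eq_add, f₂_eq_add,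
    t₂_succ, g₂_succ, h₂_succ]
  push_cast
  ring

theorem antitone_joinedRatio : Antitone joinedRatio := by
  refine antitone_nat_of_succ_le fun n => ?_
  have h₃ : (0 : ℝ) < f₂ n := by exact_mod_cast f₂_pos n
  have h₄ : (0 : ℝ) < f₂ (n + 1) := by exact_mod_cast f₂_pos (n + 1)
  rw [joinedRatio_eq, joinedRatio_eq, div_le_div_iff₀ h₄ h₃]
  rw [f₂_eq_add (n + 1), f₂_eq_add n, t₂_succ, g₂_succ, h₂_succ]
  push_cast
  have ht : (0 : ℝ) ≤ t₂ n := Nat.cast_nonneg _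
  have hg : (0 : ℝ) ≤ g₂ n := Nat.cast_nonneg _
  have hh : (0 : ℝ) ≤ h₂ n := Nat.cast_nonneg _
  generalize (t₂ n : ℝ) = t at *
  generalize (g₂ n : ℝ) = g at *
  generalize (h₂ n : ℝ) = h at *
  rw [← sub_nonneg]
  -- This is the expanded cross-multiplied difference: all negative terms cancel.
  have : 0 ≤ 2 * t ^ 2 * g ^ 2 + 10 * t ^ 2 * g * h + 2 * t ^ 2 * h ^ 2 + 16 * t * g ^ 3 +
      28 * t * g ^ 2 * h + 10 * t * g * h ^ 2 + t * h ^ 3 + 2 * t ^ 3 * h + 14 * g ^ 4 +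
      20 * g ^ 3 * h + 8 * g ^ 2 * h ^ 2 + g * h ^ 3 := by positivity
  linarith

/-! ### The two rates, their common limit and the error bound -/

/-- The upper approximations of the asymptotic growth constant. -/
def upperRate (m : ℕ) : ℝ := 2 / 3 ^ (m + 1) * Real.log (f₂ m)

/-- The lower approximations of the asymptotic growth constant. -/
def lowerRate (m : ℕ) : ℝ := 2 / 3 ^ (m + 1) * Real.log (h₂ m)

theorem upperRate_succ (m : ℕ) : upperRate (m + 1) =
    upperRate m + 2 / 3 ^ (m + 2) * Real.log (1 - joinedRatio m ^ 3) := by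
  have h₃ : (f₂ m : ℝ) ≠ 0 := by exact_mod_cast (f₂_pos m).ne'
  rw [upperRate, upperRate, f₂_succ, Real.log_mul (pow_ne_zero 3 h₃)
    (one_sub_joinedRatio_pow_pos m).ne', Real.log_pow, pow_succ 3 (m + 1)]
  push_cast
  field_simp

theorem log_one_sub_joinedRatio_neg (m : ℕ) : Real.log (1 - joinedRatio m ^ 3) < 0 :=
  Real.log_neg (one_sub_joinedRatio_pow_pos m)
    (sub_lt_self _ (pow_pos (joinedRatio_pos m) 3))

theorem strictAnti_upperRate : StrictAnti upperRate := by
  refine strictAnti_nat_of_succ_lt fun m => ?_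
  rw [upperRate_succ]
  have := mul_neg_of_pos_of_neg (by positivity : (0 : ℝ) < 2 / 3 ^ (m + 2))
    (log_one_sub_joinedRatio_neg m)
  linarith

theorem strictMono_lowerRate : StrictMono lowerRate := by
  refine strictMono_nat_of_lt_succ fun m => ?_
  have h₀ : (0 : ℝ) < h₂ m := by exact_mod_cast h₂_pos m
  have hlt : (h₂ m : ℝ) ^ 3 < h₂ (m + 1) := by
    have : 0 < 14 * g₂ m ^ 3 := by have := g₂_pos m; positivity
    have := h₂_succ m
    exact_mod_cast (by omega : h₂ m ^ 3 < h₂ (m + 1))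
  have hlog := Real.log_lt_log (pow_pos h₀ 3) hlt
  rw [Real.log_pow] at hlog
  push_cast at hlog
  have e : lowerRate m = 2 / 3 ^ (m + 2) * (3 * Real.log (h₂ m)) := by
    rw [lowerRate, pow_succ 3 (m + 1)]
    field_simp
  rw [e, lowerRate]
  exact mul_lt_mul_of_pos_left hlog (by positivity)

theorem lowerRate_le_upperRate (m : ℕ) : lowerRate m ≤ upperRate m := by
  have h₀ : (0 : ℝ) < h₂ m := by exact_mod_cast h₂_pos m
  have h₁ : (h₂ m : ℝ) ≤ f₂ m := by exact_mod_cast h₂_le_f₂ m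
  exact mul_le_mul_of_nonneg_left (Real.log_le_log h₀ h₁) (by positivity)

theorem tendsto_two_div_three_pow : Tendsto (fun m : ℕ => (2 : ℝ) / 3 ^ (m + 1)) atTop (𝓝 0) := by
  have h := (tendsto_pow_atTop_atTop_of_one_lt (by norm_num : (1 : ℝ) < 3)).comp
    (tendsto_add_atTop_nat 1)
  exact h.const_div_atTop 2

theorem tendsto_upperRate_sub_lowerRate :
    Tendsto (fun m => upperRate m - lowerRate m) atTop (𝓝 0) := by
  -- The factor 7 is the bound on f/h, so the gap is at most a vanishing multiple of log 7.
  refine squeeze_zero (g := fun m : ℕ => 2 / 3 ^ (m + 1) * Real.log 7)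
    (fun m => sub_nonneg.2 (lowerRate_le_upperRate m)) (fun m => ?_)
    (by simpa using tendsto_two_div_three_pow.mul_const (Real.log 7))
  have h₀ : (0 : ℝ) < h₂ m := by exact_mod_cast h₂_pos m
  have h₁ : (0 : ℝ) < f₂ m := by exact_mod_cast f₂_pos m
  have h₂ : (f₂ m : ℝ) ≤ 7 * h₂ m := by exact_mod_cast f₂_le_h₂ m
  have h := Real.log_le_log h₁ h₂
  rw [Real.log_mul (by norm_num) h₀.ne'] at h
  rw [upperRate, lowerRate, ← mul_sub]
  exact mul_le_mul_of_nonneg_left (by linarith) (by positivity)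

/-- The asymptotic growth constant of the spanning forests of the Sierpinski gasket. -/
def growthConstant : ℝ := ⨅ m, upperRate m

theorem bddBelow_upperRate : BddBelow (Set.range upperRate) := by
  refine ⟨lowerRate 0, ?_⟩
  rintro _ ⟨m, rfl⟩
  exact (strictMono_lowerRate.monotone (Nat.zero_le m)).trans (lowerRate_le_upperRate m)

theorem tendsto_upperRate : Tendsto upperRate atTop (𝓝 growthConstant) :=
  tendsto_atTop_ciInf strictAnti_upperRate.antitone bddBelow_upperRate

theorem tendsto_lowerRate : Tendsto lowerRate atTop (𝓝 growthConstant) := by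
  simpa using tendsto_upperRate.sub tendsto_upperRate_sub_lowerRate

theorem growthConstant_lt_upperRate (m : ℕ) : growthConstant < upperRate m :=
  (ciInf_le bddBelow_upperRate (m + 1)).trans_lt (strictAnti_upperRate m.lt_succ_self)

theorem lowerRate_lt_growthConstant (m : ℕ) : lowerRate m < growthConstant :=
  (strictMono_lowerRate m.lt_succ_self).trans_le
    (strictMono_lowerRate.monotone.ge_of_tendsto tendsto_lowerRate (m + 1))

/-- The increment is 1/3^(m+2) times the increase of ln(1 - r³), which is nonnegative because r is
nonincreasing. The weight 1/3^(m+1) is the sum of the geometric series 2/3^(k+2), k ≥ m. -/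
theorem monotone_upperRate_add_log :
    Monotone fun m => upperRate m + 1 / 3 ^ (m + 1) * Real.log (1 - joinedRatio m ^ 3) := by
  refine monotone_nat_of_le_succ fun m => ?_
  have hr : joinedRatio (m + 1) ^ 3 ≤ joinedRatio m ^ 3 :=
    pow_le_pow_left₀ (joinedRatio_pos _).le (antitone_joinedRatio m.le_succ) 3
  have hlog : Real.log (1 - joinedRatio m ^ 3) ≤ Real.log (1 - joinedRatio (m + 1) ^ 3) :=
    Real.log_le_log (one_sub_joinedRatio_pow_pos m) (by linarith)
  have e : (1 : ℝ) / 3 ^ (m + 1) = 3 * (1 / 3 ^ (m + 2)) := by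
    rw [pow_succ 3 (m + 1)]
    field_simp
  have e' : (2 : ℝ) / 3 ^ (m + 2) = 2 * (1 / 3 ^ (m + 2)) := by ring
  have := mul_le_mul_of_nonneg_left hlog (by positivity : (0 : ℝ) ≤ 1 / 3 ^ (m + 2))
  simp only [upperRate_succ, e, e']
  linarith

theorem upperRate_add_log_le_growthConstant (m : ℕ) :
    upperRate m + 1 / 3 ^ (m + 1) * Real.log (1 - joinedRatio m ^ 3) ≤ growthConstant := by
  refine ge_of_tendsto tendsto_upperRate (eventually_atTop.2 ⟨m, fun k hk => ?_⟩)
  refine (monotone_upperRate_add_log hk).trans ?_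
  have := mul_neg_of_pos_of_neg (by positivity : (0 : ℝ) < 1 / 3 ^ (k + 1))
    (log_one_sub_joinedRatio_neg k)
  simp only
  linarith

theorem tendsto_log_div_card : Tendsto (fun n : ℕ =>
    Real.log (numSpanningForests (gasket n) : ℝ) / (Fintype.card (gasketVertices n) : ℝ))
    atTop (𝓝 growthConstant) := by
  -- The inverse factor is (1 + 3/3^(n+1))⁻¹, the ratio of 3^(n+1)/2 to the number of vertices.
  have hlim : Tendsto (fun n : ℕ => upperRate n * (1 + 3 / 2 * (2 / 3 ^ (n + 1)))⁻¹) atTop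
      (𝓝 (growthConstant * (1 + 3 / 2 * 0)⁻¹)) :=
    tendsto_upperRate.mul (((tendsto_two_div_three_pow.const_mul _).const_add 1).inv₀ (by simp))
  rw [mul_zero, add_zero, inv_one, mul_one] at hlim
  refine hlim.congr fun n => ?_
  have hc : (2 : ℝ) * (gasketVertices n).card = 3 ^ (n + 1) + 3 := by
    exact_mod_cast two_mul_card_gasketVertices n
  have hc' : ((gasketVertices n).card : ℝ) = (3 ^ (n + 1) + 3) / 2 := by linarith
  rw [Fintype.card_coe, hc', upperRate, f₂]
  have h3 : (0 : ℝ) < 3 ^ (n + 1) := by positivity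
  field_simp

/-! ### Exact values up to stage 5 and numerical enclosure -/

theorem gasketTriple_one : gasketTriple 1 = (63,
    41,
    93) := by
  rw [gasketTriple_succ (t := 3) (g := 1) (h := 1) rfl]
  norm_num

theorem gasketTriple_two : gasketTriple 2 = (1294083,
    2022893,
    13230013) := by
  rw [gasketTriple_succ gasketTriple_one]
  norm_num

theorem gasketTriple_three : gasketTriple 3 = (36212372367917382063,
    215741040104979715185,
    8012691266099095194581) := by
  rw [gasketTriple_succ gasketTriple_two]
  norm_num

theorem gasketTriple_four : gasketTriple 4 = (6753881155395148881201426976445689795306086050248316402204115,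
    560614128405294924967963949426699864403889049807377599334701549,
    655919304210118002541330687585664958624488147511374557764105420845) := by
  rw [gasketTriple_succ gasketTriple_three]
  norm_num

theorem gasketTriple_five : gasketTriple 5 = (6521429653930618644419282836842499286297343079550630547705918352100704377325776626711674902947710869145613156767225935595774900697288540537712592654278044842823246061600708440347760598495,
    211864296410596547224223086594134526691309325089221051269479922730514979588987073674635041176918197450159410727791876767349699653246370012014325711240272942003735796475912908218190811384911521,
    284380684710155579842508894598511452937244207244035070232639124014013754570114464131609318807933794265665528127006222619895359977032837671598005469838881635553932965572295912763696932655904990883541) := by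
  rw [gasketTriple_succ gasketTriple_four]
  norm_num

/-- The series of log(1 - x) at x = 1/2; after 56 terms the remainder is at most 2^-56. Such
precision is needed because log 2 is multiplied by 656 below. -/
theorem log_two_bounds :
    0.6931471805599452 ≤ Real.log 2 ∧ Real.log 2 ≤ 0.69314718055996 := by
  have h := Real.abs_log_sub_add_sum_range_le (x := 1 / 2) (by norm_num [abs_of_pos]) 56
  have e : Real.log (1 - 1 / 2) = -Real.log 2 := by
    rw [← Real.log_inv]
    norm_num
  rw [e, abs_of_pos (by norm_num : (0 : ℝ) < 1 / 2)] at h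
  simp only [Finset.sum_range_succ, Finset.sum_range_zero] at h
  rw [abs_le] at h
  norm_num at h
  constructor
  · linarith [h.2]
  · linarith [h.1]

-- Factoring out 2^656, the least power of two above f(5), leaves 1 - x with x ≈ 0.0489, for which
-- eight terms of the logarithm series suffice. The resulting width, about 1.5e-9, is multiplied by
-- 2/3^6, hence is below the eleventh decimal.
set_option exponentiation.threshold 700 in
theorem log_f₂_five_bounds :
    454.654409148496 ≤ Real.log (f₂ 5) ∧ Real.log (f₂ 5) ≤ 454.65440915 := by
  have hx : ∀ x : ℝ, |x| < 1 → |x + x ^ 2 / 2 + x ^ 3 / 3 + x ^ 4 / 4 + x ^ 5 / 5 + x ^ 6 / 6 +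
      x ^ 7 / 7 + x ^ 8 / 8 + Real.log (1 - x)| ≤ |x| ^ 9 / (1 - |x|) := by
    intro x hx
    have h := Real.abs_log_sub_add_sum_range_le hx 8
    simp only [Finset.sum_range_succ, Finset.sum_range_zero] at h
    norm_num at h
    exact h
  have hf : (f₂ 5 : ℝ) = 6521429653930618644419282836842499286297343079550630547705918352100704377325776626711674902947710869145613156767225935595774900697288540537712592654278044842823246061600708440347760598495 + 3 * 211864296410596547224223086594134526691309325089221051269479922730514979588987073674635041176918197450159410727791876767349699653246370012014325711240272942003735796475912908218190811384911521 + 284380684710155579842508894598511452937244207244035070232639124014013754570114464131609318807933794265665528127006222619895359977032837671598005469838881635553932965572295912763696932655904990883541 := by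
    rw [f₂_eq, gasketTriple_five]
    norm_num
  have hlo : (2 : ℝ) ^ 656 * (1 - 0.0489049735445244) ≤ f₂ 5 := by rw [hf]; norm_num
  have hhi : (f₂ 5 : ℝ) ≤ 2 ^ 656 * (1 - 0.0489049735445) := by rw [hf]; norm_num
  have hlo' := Real.log_le_log (by norm_num) hlo
  have hhi' := Real.log_le_log (by exact_mod_cast f₂_pos 5) hhi
  rw [Real.log_mul (by positivity) (by norm_num), Real.log_pow] at hlo' hhi'
  push_cast at hlo' hhi'
  have a := hx 0.0489049735445244 (by norm_num [abs_of_pos])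
  have b := hx 0.0489049735445 (by norm_num [abs_of_pos])
  rw [abs_of_pos (by norm_num : (0 : ℝ) < 0.0489049735445244), abs_le] at a
  rw [abs_of_pos (by norm_num : (0 : ℝ) < 0.0489049735445), abs_le] at b
  obtain ⟨l₁, l₂⟩ := log_two_bounds
  constructor
  · have := a.1
    generalize Real.log (1 - 0.0489049735445244) = y at *
    norm_num at this
    linarith
  · have := b.2
    generalize Real.log (1 - 0.0489049735445) = y at *
    norm_num at this
    linarith

theorem joinedRatio_five_le : joinedRatio 5 ≤ 1 / 10 ^ 6 := by
  have h₃ : (0 : ℝ) < f₂ 5 := by exact_mod_cast f₂_pos 5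
  rw [joinedRatio_eq, div_le_div_iff₀ h₃ (by norm_num), f₂_eq, t₂_eq, g₂_eq, gasketTriple_five]
  norm_num

theorem growthConstant_lower_bound : 1.24733719931 ≤ growthConstant := by
  have hr : joinedRatio 5 ^ 3 ≤ 1 / 10 ^ 18 :=
    (pow_le_pow_left₀ (joinedRatio_pos 5).le joinedRatio_five_le 3).trans (by norm_num)
  -- From log y ≥ 1 - 1/y at y = 1 - ε with ε = 10^-18, since ε/(1 - ε) ≤ 2ε.
  have hl : -(2 / 10 ^ 18) ≤ Real.log (1 - joinedRatio 5 ^ 3) := by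
    have hpos : (0 : ℝ) < 1 - 1 / 10 ^ 18 := by norm_num
    have h₁ := Real.one_sub_inv_le_log_of_pos hpos
    have h₂ : Real.log (1 - 1 / 10 ^ 18) ≤ Real.log (1 - joinedRatio 5 ^ 3) :=
      Real.log_le_log hpos (by linarith)
    refine le_trans ?_ (h₁.trans h₂)
    norm_num
  have h := upperRate_add_log_le_growthConstant 5
  have hf := log_f₂_five_bounds.1
  rw [upperRate] at h
  norm_num at h hl hf ⊢
  linarith

theorem growthConstant_upper_bound : growthConstant < 1.24733719932 := by
  refine (growthConstant_lt_upperRate 5).trans_le ?_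
  have hf := log_f₂_five_bounds.2
  rw [upperRate]
  norm_num at hf ⊢
  linarith

end

theorem proposition1 :
    ∃ z : ℝ,
      Tendsto (fun n : ℕ => Real.log (numSpanningForests (gasket n) : ℝ) /
        (Fintype.card (gasketVertices n) : ℝ)) atTop (𝓝 z) ∧
      (1.24733719931 ≤ z ∧ z < 1.24733719932) ∧
      (∀ m : ℕ, 1 ≤ m →
        2 / 3 ^ (m + 1) * Real.log (h₂ m : ℝ) < z ∧
        z < 2 / 3 ^ (m + 1) * Real.log (f₂ m : ℝ)) ∧
      (∀ m : ℕ, 1 ≤ m →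
        2 / 3 ^ (m + 1) * Real.log (f₂ m : ℝ) - z ≤
          -1 / 3 ^ (m + 1) *
            Real.log (1 - ((t₂ m : ℝ) / (f₂ m : ℝ) + (g₂ m : ℝ) / (f₂ m : ℝ)) ^ 3)) ∧
      Tendsto (fun m : ℕ => 2 / 3 ^ (m + 1) * Real.log (h₂ m : ℝ)) atTop (𝓝 z) ∧
      Tendsto (fun m : ℕ => 2 / 3 ^ (m + 1) * Real.log (f₂ m : ℝ)) atTop (𝓝 z) := by
  refine ⟨growthConstant, tendsto_log_div_card, ⟨growthConstant_lower_bound,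
    growthConstant_upper_bound⟩, fun m _ => ⟨lowerRate_lt_growthConstant m,
    growthConstant_lt_upperRate m⟩, fun m _ => ?_, tendsto_lowerRate, tendsto_upperRate⟩
  have h := upperRate_add_log_le_growthConstant m
  rw [upperRate, joinedRatio] at h
  have e : (-1 : ℝ) / 3 ^ (m + 1) = -(1 / 3 ^ (m + 1)) := by ring
  rw [e]
  linarith
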